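/- Formulas are built from denumerably many propositional variables with the connectives $\wedge,\&,\to,\overline 0$ of the monoidal t-norm based logic $\mathrm{MTL}$ and possibly further connectives of finite arity; $\neg\varphi:=\varphi\to\overline 0$, $\overline 1:=\neg\overline 0$, $\varphi\vee\psi:=((\varphi\to\psi)\to\psi)\wedge((\psi\to\varphi)\to\varphi)$ and $\varphi\leftrightarrow\psi:=(\varphi\to\psi)\wedge(\psi\to\varphi)$. Let $\mathrm L$ be a semilinear core expansion of $\mathrm{MTL}$, that is, a logic axiomatized by axiom schemata and finitary inference rules, in a language containing that of $\mathrm{MTL}$, such that * $\mathrm L$ proves every consequence of $\mathrm{MTL}$; * for every additional $n$-ary connective $c$ and every argument place of $c$, $\{\varphi\to\psi,\ \psi\to\varphi\}\vdash_{\mathrm L} c(\chi_1,\dots,\varphi,\dots,\chi_n)\to c(\chi_1,\dots,\psi,\dots,\chi_n)$; * $\mathrm L$ is strongly complete with respect to the class of $\mathrm L$-chains, i.e. of linearly ordered $\mathrm L$-algebras. Here an $\mathrm L$-algebra is an $\mathrm{MTL}$-algebra (a commutative bounded integral residuated lattice satisfying $(x\to y)\vee(y\to x)=1$), with an operation for each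 additional connective, in which every consequence of $\mathrm L$ is valid: if $\Gamma\vdash_{\mathrm L}\varphi$, then every evaluation giving value $1$ to all members of $\Gamma$ gives value $1$ to $\varphi$. Let $\mathrm L_\circ$ be the expansion of $\mathrm L$ by a new unary connective $\circ$, obtained by adding to the axioms and rules of $\mathrm L$ (for all formulas of the new language) the axioms $\neg(\varphi\wedge\neg\varphi\wedge\circ\varphi)$, $\circ\overline 1$, $\circ\overline 0$ and the rules $$\frac{(\varphi\leftrightarrow\psi)\vee\delta}{(\circ\varphi\leftrightarrow\circ\psi)\vee\delta},\qquad \frac{(\neg\neg\varphi\wedge(\varphi\to\psi))\vee\delta}{(\circ\varphi\to\circ\psi)\vee\delta}.$$ A logic has the finite strong real-chain completeness property if for every finite set $T$ of formulas and every formula $\varphi$: $T\vdash\varphi$ if and only if, in every chain of the logic whose underlying ordered set is the real unit interval $[0,1]$, every evaluation giving value $1$ to all members of $T$ gives value $1$ to $\varphi$. Then $\mathrm L$ has the finite strong real-chain completeness property if and only if $\mathrm L_\circ$ has it. -/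

import Mathlib

universe u v

namespace FuzzyLFI

/-- A propositional language expanding the one of MTL: a type of additional connectives (possibly
empty, possibly infinite), each with a finite arity. The connectives of MTL are built into
`Formula`. -/
structure Signature where
  Conn : Type u
  arity : Conn → ℕ

/-- Formulas over denumerably many variables, the primitive connectives of MTL
(truth constant `0`, `∧`, `&`, `→`) and the additional connectives of `S`. -/
inductive Formula (S : Signature.{u}) : Type u
  | var (n : ℕ) : Formula S
  | bot : Formula S
  | and (φ ψ : Formula S) : Formula S
  | amp (φ ψ : Formula S) : Formula S
  | imp (φ ψ : Formula S) : Formula S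
  | conn (c : S.Conn) (args : Fin (S.arity c) → Formula S) : Formula S

namespace Formula

variable {S : Signature.{u}}

/-- `¬φ` is `φ → 0`. -/
def neg (φ : Formula S) : Formula S := imp φ bot

/-- The constant `1` is `¬0`. -/
def top : Formula S := neg bot

/-- `φ ∨ ψ` is `((φ → ψ) → ψ) ∧ ((ψ → φ) → φ)`. -/
def or (φ ψ : Formula S) : Formula S := and (imp (imp φ ψ) ψ) (imp (imp ψ φ) φ)

/-- `φ ↔ ψ` is `(φ → ψ) ∧ (ψ → φ)`. -/
def equiv (φ ψ : Formula S) : Formula S := and (imp φ ψ) (imp ψ φ)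

/-- Simultaneous substitution of formulas for variables. -/
def subst (σ : ℕ → Formula S) : Formula S → Formula S
  | var n => σ n
  | bot => bot
  | and φ ψ => and (subst σ φ) (subst σ ψ)
  | amp φ ψ => amp (subst σ φ) (subst σ ψ)
  | imp φ ψ => imp (subst σ φ) (subst σ ψ)
  | conn c args => conn c (fun i => subst σ (args i))

end Formula

/-- A finitary inference rule (schema); its instances are obtained by substituting formulas for
variables. An axiom (schema) is a rule without premises. -/
structure Rule (S : Signature.{u}) where
  premises : List (Formula S)
  conclusion : Formula S

/-- A finitary structural logic in the language `S`, given by an axiomatization: a (possibly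
infinite) set of axiom schemata and finitary rules. -/
structure Logic (S : Signature.{u}) where
  rules : Set (Rule S)

section MTL

open Formula

/-- The axiom schemata of MTL and modus ponens, on formulas of the language `S`. -/
inductive MTLRule (S : Signature.{u}) : Rule S → Prop
  | A1 : MTLRule S ⟨[], imp (imp (var 0) (var 1))
      (imp (imp (var 1) (var 2)) (imp (var 0) (var 2)))⟩
  | A2 : MTLRule S ⟨[], imp (amp (var 0) (var 1)) (var 0)⟩
  | A3 : MTLRule S ⟨[], imp (amp (var 0) (var 1)) (amp (var 1) (var 0))⟩
  | A4 : MTLRule S ⟨[], imp (and (var 0) (var 1)) (var 0)⟩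
  | A5 : MTLRule S ⟨[], imp (and (var 0) (var 1)) (and (var 1) (var 0))⟩
  | A6 : MTLRule S ⟨[], imp (amp (var 0) (imp (var 0) (var 1))) (and (var 0) (var 1))⟩
  | A7a : MTLRule S ⟨[], imp (imp (var 0) (imp (var 1) (var 2)))
      (imp (amp (var 0) (var 1)) (var 2))⟩
  | A7b : MTLRule S ⟨[], imp (imp (amp (var 0) (var 1)) (var 2))
      (imp (var 0) (imp (var 1) (var 2)))⟩
  | A8 : MTLRule S ⟨[], imp (imp (imp (var 0) (var 1)) (var 2))
      (imp (imp (imp (var 1) (var 0)) (var 2)) (var 2))⟩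
  | A9 : MTLRule S ⟨[], imp bot (var 0)⟩
  | MP : MTLRule S ⟨[var 0, imp (var 0) (var 1)], var 1⟩

/-- The logic MTL, read in the language `S`. -/
def MTL (S : Signature.{u}) : Logic S := ⟨{r | MTLRule S r}⟩

end MTL

/-- `L.Derives Γ φ` is `Γ ⊢_L φ`: there is a derivation of `φ` from premises in `Γ` using
substitution instances of the axioms and rules of `L`. -/
inductive Logic.Derives {S : Signature.{u}} (L : Logic S) (Γ : Set (Formula S)) :
    Formula S → Prop
  | hyp {φ : Formula S} (h : φ ∈ Γ) : Logic.Derives L Γ φ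
  | rule {r : Rule S} (hr : r ∈ L.rules) (σ : ℕ → Formula S)
      (h : ∀ ψ ∈ r.premises, Logic.Derives L Γ (ψ.subst σ)) :
      Logic.Derives L Γ (r.conclusion.subst σ)

/-- A core expansion of MTL: a (finitary) logic which proves all that MTL proves and satisfies
the congruence property `φ → ψ, ψ → φ ⊢ c(.., φ, ..) → c(.., ψ, ..)` for every additional
connective `c` and every argument place of `c`. -/
structure Logic.IsCoreExpansion {S : Signature.{u}} (L : Logic S) : Prop where
  expands : ∀ (Γ : Set (Formula S)) (φ : Formula S), (MTL S).Derives Γ φ → L.Derives Γ φ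
  cong : ∀ (c : S.Conn) (χ : Fin (S.arity c) → Formula S) (i : Fin (S.arity c))
    (φ ψ : Formula S), L.Derives {Formula.imp φ ψ, Formula.imp ψ φ}
      (Formula.imp (Formula.conn c (Function.update χ i φ))
        (Formula.conn c (Function.update χ i ψ)))

/-- An MTL-algebra (a commutative bounded integral residuated lattice satisfying prelinearity) on
the bounded lattice `A`, with an operation for each additional connective of `S`. Meet, join, `0`
and `1` are those of the lattice. -/
structure Alg (S : Signature.{u}) (A : Type v) [Lattice A] [BoundedOrder A] where
  amp : A → A → A
  imp : A → A → A
  amp_assoc : ∀ x y z, amp (amp x y) z = amp x (amp y z)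
  amp_comm : ∀ x y, amp x y = amp y x
  top_amp : ∀ x, amp ⊤ x = x
  residuation : ∀ x y z, amp x y ≤ z ↔ x ≤ imp y z
  prelinear : ∀ x y, imp x y ⊔ imp y x = ⊤
  op : (c : S.Conn) → (Fin (S.arity c) → A) → A

/-- The value of a formula under the evaluation determined by `e` on the variables. -/
def Alg.eval {S : Signature.{u}} {A : Type v} [Lattice A] [BoundedOrder A] (𝔸 : Alg S A)
    (e : ℕ → A) : Formula S → A
  | .var n => e n
  | .bot => ⊥
  | .and φ ψ => 𝔸.eval e φ ⊓ 𝔸.eval e ψ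
  | .amp φ ψ => 𝔸.amp (𝔸.eval e φ) (𝔸.eval e ψ)
  | .imp φ ψ => 𝔸.imp (𝔸.eval e φ) (𝔸.eval e ψ)
  | .conn c args => 𝔸.op c (fun i => 𝔸.eval e (args i))

/-- Every `𝔸`-evaluation that is a model of `Γ` is a model of `φ`. -/
def Alg.Entails {S : Signature.{u}} {A : Type v} [Lattice A] [BoundedOrder A] (𝔸 : Alg S A)
    (Γ : Set (Formula S)) (φ : Formula S) : Prop :=
  ∀ e : ℕ → A, (∀ γ ∈ Γ, 𝔸.eval e γ = ⊤) → 𝔸.eval e φ = ⊤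

/-- `𝔸` is an `L`-algebra: it validates all consequences of `L`. -/
def Logic.IsAlgebra {S : Signature.{u}} (L : Logic S) {A : Type v} [Lattice A] [BoundedOrder A]
    (𝔸 : Alg S A) : Prop :=
  ∀ (Γ : Set (Formula S)) (φ : Formula S), L.Derives Γ φ → 𝔸.Entails Γ φ

/-- `L` is semilinear: it is strongly complete with respect to the class of `L`-chains. -/
def Logic.IsSemilinear {S : Signature.{u}} (L : Logic S) : Prop :=
  ∀ (Γ : Set (Formula S)) (φ : Formula S), L.Derives Γ φ ↔
    ∀ (A : Type u) [LinearOrder A] [BoundedOrder A] (𝔸 : Alg S A),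
      L.IsAlgebra 𝔸 → 𝔸.Entails Γ φ

/-- The finite strong real-chain completeness property: for every finite `T` and every `φ`,
`T ⊢_L φ` iff `φ` follows from `T` in every real `L`-chain, that is, every `L`-chain on the unit
interval `[0, 1]` with its usual order. -/
def Logic.FSRC {S : Signature.{u}} (L : Logic S) : Prop :=
  ∀ (T : Set (Formula S)) (φ : Formula S), T.Finite →
    (L.Derives T φ ↔ ∀ 𝔸 : Alg S unitInterval, L.IsAlgebra 𝔸 → 𝔸.Entails T φ)

/-- The language `S` with one new unary connective (the consistency operator). -/
def Signature.addCirc (S : Signature.{u}) : Signature.{u} where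
  Conn := S.Conn ⊕ Unit
  arity := Sum.elim S.arity (fun _ => 1)

/-- The formula `∘φ`. -/
def Formula.circ {S : Signature.{u}} (φ : Formula S.addCirc) : Formula S.addCirc :=
  .conn (S := S.addCirc) (Sum.inr ()) (fun _ => φ)

/-- Formulas of the language `S` as formulas of the expanded language. -/
def Formula.lift {S : Signature.{u}} : Formula S → Formula S.addCirc
  | .var n => .var n
  | .bot => .bot
  | .and φ ψ => .and φ.lift ψ.lift
  | .amp φ ψ => .amp φ.lift ψ.lift
  | .imp φ ψ => .imp φ.lift ψ.lift
  | .conn c args => .conn (S := S.addCirc) (Sum.inl c) (fun i => (args i).lift)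

/-- Rules of the language `S` as rules of the expanded language. -/
def Rule.lift {S : Signature.{u}} (r : Rule S) : Rule S.addCirc :=
  ⟨r.premises.map Formula.lift, r.conclusion.lift⟩

section Circ

open Formula

/-- The axioms and rules for the consistency operator. -/
inductive CircRule (S : Signature.{u}) : Rule S.addCirc → Prop
  | A1 : CircRule S ⟨[], neg (and (and (var 0) (neg (var 0))) (circ (var 0)))⟩
  | A2 : CircRule S ⟨[], circ top⟩
  | A3 : CircRule S ⟨[], circ bot⟩
  | Cong : CircRule S ⟨[or (equiv (var 0) (var 1)) (var 2)],
      or (equiv (circ (var 0)) (circ (var 1))) (var 2)⟩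
  | Coh : CircRule S ⟨[or (and (neg (neg (var 0))) (imp (var 0) (var 1))) (var 2)],
      or (imp (circ (var 0)) (circ (var 1))) (var 2)⟩

/-- The expansion `L_∘` of `L`: the axioms and rules of `L`, now for all formulas of the expanded
language, together with those for the consistency operator. -/
def Logic.addCirc {S : Signature.{u}} (L : Logic S) : Logic S.addCirc :=
  ⟨Rule.lift '' L.rules ∪ {r | CircRule S r}⟩

end Circ

end FuzzyLFI

-- On a chain, a disjunction has value `⊤` only if a disjunct does, and an implication has value `⊤`
-- only if the order says so. Hence the axioms and rules for `∘` say exactly that it is a map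
-- sending `⊥` and `⊤` to `⊤`, vanishing at every other `x` with `¬x ≠ ⊥`, and monotone on the
-- elements with `¬x = ⊥`. Nothing ties `∘` to the remaining connectives, so any map of this kind
-- turns an `L`-chain into an `L_∘`-chain (`Logic.IsAlgebra.addCirc`).
--
-- From `L_∘` to `L`: every nontrivial `L`-chain carries such a map, so `L_∘` is conservative over
-- `L`, and real `L_∘`-chains have real `L`-chains as reducts.
--
-- From `L` to `L_∘`: first, `L_∘` is again semilinear. Its rules are stable under adding a
-- disjunct, which yields proof by cases, hence extension to linear theories and linearly ordered
-- Lindenbaum algebras. A failed consequence of `L_∘` therefore has a countermodel on some chain.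
-- Only finitely many subformulas `∘χ` occur; replacing them by fresh variables leaves finitely many
-- formulas of `L`. The order pattern of their values is recorded by implications that hold and a
-- disjunction of implications that fail, so the property for `L` realizes it in a real chain
-- (`exists_real_chain`). There the finitely many prescribed values of `∘` are interpolated by a
-- monotone step function (`exists_transfer`), and the countermodel is rebuilt on `[0,1]`.

universe w

namespace FuzzyLFI

open Formula

variable {S : Signature.{u}}

/-! ### Values of the connectives in an MTL-chain -/

section Chain

variable {A : Type v} [LinearOrder A] [BoundedOrder A] (𝔸 : Alg S A)

theorem Alg.imp_eq_top {x y : A} : 𝔸.imp x y = ⊤ ↔ x ≤ y := by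
  rw [← top_le_iff, ← 𝔸.residuation, 𝔸.top_amp]

theorem Alg.top_imp (y : A) : 𝔸.imp ⊤ y = y := by
  apply eq_of_forall_le_iff
  intro x
  rw [← 𝔸.residuation, 𝔸.amp_comm, 𝔸.top_amp]

theorem Alg.le_imp_imp (x y : A) : x ≤ 𝔸.imp (𝔸.imp x y) y := by
  rw [← 𝔸.residuation, 𝔸.amp_comm, 𝔸.residuation]

theorem Alg.bot_imp (y : A) : 𝔸.imp ⊥ y = ⊤ := 𝔸.imp_eq_top.2 bot_le

theorem sup_eq_top_iff_of_linear {x y : A} : x ⊔ y = ⊤ ↔ x = ⊤ ∨ y = ⊤ := by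
  rcases le_total x y with h | h
  · rw [sup_eq_right.2 h]
    exact ⟨Or.inr, fun k => k.elim (fun k => top_le_iff.1 (k ▸ h)) id⟩
  · rw [sup_eq_left.2 h]
    exact ⟨Or.inl, fun k => k.elim id (fun k => top_le_iff.1 (k ▸ h))⟩

theorem Alg.join_eq (x y : A) :
    𝔸.imp (𝔸.imp x y) y ⊓ 𝔸.imp (𝔸.imp y x) x = x ⊔ y := by
  rcases le_total x y with h | h
  · rw [𝔸.imp_eq_top.2 h, 𝔸.top_imp, sup_eq_right.2 h, inf_eq_left.2 (𝔸.le_imp_imp y x)]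
  · rw [𝔸.imp_eq_top.2 h, 𝔸.top_imp, sup_eq_left.2 h, inf_eq_right.2 (𝔸.le_imp_imp x y)]

theorem Alg.eval_or (e : ℕ → A) (φ ψ : Formula S) :
    𝔸.eval e (or φ ψ) = 𝔸.eval e φ ⊔ 𝔸.eval e ψ := 𝔸.join_eq _ _

theorem Alg.eval_or_eq_top (e : ℕ → A) (φ ψ : Formula S) :
    𝔸.eval e (or φ ψ) = ⊤ ↔ 𝔸.eval e φ = ⊤ ∨ 𝔸.eval e ψ = ⊤ := by
  rw [𝔸.eval_or, sup_eq_top_iff_of_linear]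

theorem Alg.eval_imp_eq_top (e : ℕ → A) (φ ψ : Formula S) :
    𝔸.eval e (Formula.imp φ ψ) = ⊤ ↔ 𝔸.eval e φ ≤ 𝔸.eval e ψ := 𝔸.imp_eq_top

theorem Alg.eval_top (e : ℕ → A) : 𝔸.eval e top = ⊤ := 𝔸.bot_imp ⊥

theorem Alg.eval_equiv_eq_top (e : ℕ → A) (φ ψ : Formula S) :
    𝔸.eval e (equiv φ ψ) = ⊤ ↔ 𝔸.eval e φ = 𝔸.eval e ψ := by
  change 𝔸.imp _ _ ⊓ 𝔸.imp _ _ = ⊤ ↔ _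
  rw [inf_eq_top_iff, 𝔸.imp_eq_top, 𝔸.imp_eq_top, le_antisymm_iff]

end Chain

/-! ### Substitution, reducts and expansions -/

section Substitution

variable {A : Type v} [Lattice A] [BoundedOrder A]

theorem Alg.eval_subst (𝔸 : Alg S A) (e : ℕ → A) (σ : ℕ → Formula S) (φ : Formula S) :
    𝔸.eval e (φ.subst σ) = 𝔸.eval (fun n => 𝔸.eval e (σ n)) φ := by
  induction φ with
  | var n => rfl
  | bot => rfl
  | and φ ψ h k => simp only [Formula.subst, Alg.eval, h, k]
  | amp φ ψ h k => simp only [Formula.subst, Alg.eval, h, k]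
  | imp φ ψ h k => simp only [Formula.subst, Alg.eval, h, k]
  | conn c args h => simp only [Formula.subst, Alg.eval, h]

/-- The reduct of an algebra to the language without `∘`. -/
def Alg.reduct (𝔹 : Alg S.addCirc A) : Alg S A where
  amp := 𝔹.amp
  imp := 𝔹.imp
  amp_assoc := 𝔹.amp_assoc
  amp_comm := 𝔹.amp_comm
  top_amp := 𝔹.top_amp
  residuation := 𝔹.residuation
  prelinear := 𝔹.prelinear
  op c x := 𝔹.op (Sum.inl c) x

/-- The operation interpreting `∘`. -/
def Alg.circ (𝔹 : Alg S.addCirc A) (x : A) : A := 𝔹.op (Sum.inr ()) (fun _ => x)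

/-- The expansion of an algebra by an operation interpreting `∘`. -/
def Alg.addCirc (𝔸 : Alg S A) (f : A → A) : Alg S.addCirc A where
  amp := 𝔸.amp
  imp := 𝔸.imp
  amp_assoc := 𝔸.amp_assoc
  amp_comm := 𝔸.amp_comm
  top_amp := 𝔸.top_amp
  residuation := 𝔸.residuation
  prelinear := 𝔸.prelinear
  op c := match c with
    | Sum.inl c => 𝔸.op c
    | Sum.inr _ => fun x => f (x (0 : Fin 1))

theorem Alg.eval_circ (𝔹 : Alg S.addCirc A) (e : ℕ → A) (φ : Formula S.addCirc) :
    𝔹.eval e (Formula.circ φ) = 𝔹.circ (𝔹.eval e φ) := rfl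

theorem Alg.eval_lift (𝔹 : Alg S.addCirc A) (e : ℕ → A) (φ : Formula S) :
    𝔹.eval e φ.lift = 𝔹.reduct.eval e φ := by
  induction φ with
  | var n => rfl
  | bot => rfl
  | and φ ψ h k => simp only [Formula.lift, Alg.eval, h, k]
  | amp φ ψ h k => simp only [Formula.lift, Alg.eval, h, k]; rfl
  | imp φ ψ h k => simp only [Formula.lift, Alg.eval, h, k]; rfl
  | conn c args h => exact congrArg (𝔹.op (Sum.inl c)) (funext h)

theorem Formula.subst_subst (σ τ : ℕ → Formula S) (φ : Formula S) :
    (φ.subst σ).subst τ = φ.subst (fun n => (σ n).subst τ) := by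
  induction φ with
  | var n => rfl
  | bot => rfl
  | and φ ψ h k => simp only [Formula.subst, h, k]
  | amp φ ψ h k => simp only [Formula.subst, h, k]
  | imp φ ψ h k => simp only [Formula.subst, h, k]
  | conn c args h => simp only [Formula.subst, h]

theorem Formula.subst_var (φ : Formula S) : φ.subst var = φ := by
  induction φ with
  | var n => rfl
  | bot => rfl
  | and φ ψ h k => simp only [Formula.subst, h, k]
  | amp φ ψ h k => simp only [Formula.subst, h, k]
  | imp φ ψ h k => simp only [Formula.subst, h, k]
  | conn c args h => simp only [Formula.subst, h]

theorem Formula.lift_subst (σ : ℕ → Formula S) (φ : Formula S) :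
    (φ.subst σ).lift = φ.lift.subst (fun n => (σ n).lift) := by
  induction φ with
  | var n => rfl
  | bot => rfl
  | and φ ψ h k => simp only [Formula.subst, Formula.lift, h, k]
  | amp φ ψ h k => simp only [Formula.subst, Formula.lift, h, k]
  | imp φ ψ h k => simp only [Formula.subst, Formula.lift, h, k]
  | conn c args h => exact congrArg (conn (S := S.addCirc) (Sum.inl c)) (funext h)

end Substitution

/-! ### Soundness, and passage of derivations from `L` to `L_∘` -/

theorem Logic.derives_of_rule (L : Logic S) {r : Rule S} (hr : r ∈ L.rules) :
    L.Derives {ψ | ψ ∈ r.premises} r.conclusion := by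
  have h := Logic.Derives.rule (L := L) (Γ := {ψ | ψ ∈ r.premises}) hr var
    (fun ψ hψ => Logic.Derives.hyp (by rw [subst_var]; exact hψ))
  rwa [subst_var] at h

/-- An algebra validating the rules of a logic validates all its consequences. -/
theorem Logic.isAlgebra_of_rules {A : Type v} [Lattice A] [BoundedOrder A] (L : Logic S)
    (𝔸 : Alg S A) (h : ∀ r ∈ L.rules, 𝔸.Entails {ψ | ψ ∈ r.premises} r.conclusion) :
    L.IsAlgebra 𝔸 := by
  intro Γ φ hφ e he
  induction hφ with
  | hyp hγ => exact he _ hγ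
  | rule hr σ _ ih =>
    rw [𝔸.eval_subst]
    refine h _ hr _ (fun ψ hψ => ?_)
    rw [← 𝔸.eval_subst]
    exact ih ψ hψ

theorem Logic.Derives.cut {L : Logic S} {Γ Δ : Set (Formula S)} {φ : Formula S}
    (h : L.Derives Γ φ) (hΓ : ∀ γ ∈ Γ, L.Derives Δ γ) : L.Derives Δ φ := by
  induction h with
  | hyp hγ => exact hΓ _ hγ
  | rule hr σ _ ih => exact .rule hr σ ih

/-- Substitution instances, in the expanded language, of consequences of `L` hold in `L_∘`. -/
theorem Logic.Derives.addCirc {L : Logic S} {Γ : Set (Formula S)} {φ : Formula S}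
    (h : L.Derives Γ φ) (σ : ℕ → Formula S.addCirc) {Δ : Set (Formula S.addCirc)}
    (hΔ : ∀ γ ∈ Γ, L.addCirc.Derives Δ (γ.lift.subst σ)) :
    L.addCirc.Derives Δ (φ.lift.subst σ) := by
  induction h with
  | hyp hγ => exact hΔ _ hγ
  | @rule r hr τ _ ih =>
    rw [lift_subst, subst_subst]
    refine Logic.Derives.rule (L := L.addCirc) (r := r.lift) (Or.inl ⟨r, hr, rfl⟩) _ (fun ψ hψ => ?_)
    obtain ⟨χ, hχ, rfl⟩ := List.mem_map.1 hψ
    have := ih χ hχ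
    rwa [lift_subst, subst_subst] at this

theorem Logic.Derives.lift {L : Logic S} {Γ : Set (Formula S)} {φ : Formula S}
    (h : L.Derives Γ φ) : L.addCirc.Derives (Formula.lift '' Γ) φ.lift := by
  have := h.addCirc var (Δ := Formula.lift '' Γ)
    (fun γ hγ => .hyp (by rw [subst_var]; exact ⟨γ, hγ, rfl⟩))
  rwa [subst_var] at this

theorem Logic.IsAlgebra.reduct {A : Type v} [Lattice A] [BoundedOrder A] {L : Logic S}
    {𝔹 : Alg S.addCirc A} (h : L.addCirc.IsAlgebra 𝔹) : L.IsAlgebra 𝔹.reduct := by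
  intro Γ φ hφ e he
  rw [← 𝔹.eval_lift]
  refine h _ _ hφ.lift e ?_
  rintro _ ⟨γ, hγ, rfl⟩
  rw [𝔹.eval_lift]
  exact he γ hγ

/-! ### Consistency operators on chains -/

/-- On a chain, the operations interpreting `∘`. -/
structure Alg.IsConsistency {A : Type v} [LinearOrder A] [BoundedOrder A] (𝔸 : Alg S A)
    (f : A → A) : Prop where
  top : f ⊤ = ⊤
  bot : f ⊥ = ⊤
  eq_bot : ∀ x, x ≠ ⊥ → 𝔸.imp x ⊥ ≠ ⊥ → f x = ⊥
  mono : ∀ x y, 𝔸.imp x ⊥ = ⊥ → x ≤ y → f x ≤ f y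

section

variable {A : Type v} [LinearOrder A] [BoundedOrder A]

theorem Logic.IsAlgebra.addCirc {L : Logic S} {𝔸 : Alg S A} (h : L.IsAlgebra 𝔸) {f : A → A}
    (hf : 𝔸.IsConsistency f) : L.addCirc.IsAlgebra (𝔸.addCirc f) := by
  apply Logic.isAlgebra_of_rules
  rintro _ (⟨r, hr, rfl⟩ | hr) e he
  · refine ((𝔸.addCirc f).eval_lift e r.conclusion).trans
      (h _ _ (L.derives_of_rule hr) e (fun ψ hψ => ?_))
    exact ((𝔸.addCirc f).eval_lift e ψ).symm.trans (he ψ.lift (List.mem_map_of_mem hψ))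
  · cases hr with
    | A1 =>
      refine 𝔸.imp_eq_top.2 ?_
      change (e 0 ⊓ 𝔸.imp (e 0) ⊥) ⊓ f (e 0) ≤ ⊥
      by_cases h0 : e 0 = ⊥
      · rw [h0]; exact inf_le_left.trans inf_le_left
      by_cases h1 : 𝔸.imp (e 0) ⊥ = ⊥
      · rw [h1]; exact inf_le_left.trans inf_le_right
      · rw [hf.eq_bot _ h0 h1]; exact inf_le_right
    | A2 => exact (congrArg f (𝔸.bot_imp ⊥)).trans hf.top
    | A3 => exact hf.bot
    | Cong =>
      rw [Alg.eval_or_eq_top, Alg.eval_equiv_eq_top]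
      have := he _ (List.mem_singleton_self _)
      rw [Alg.eval_or_eq_top, Alg.eval_equiv_eq_top] at this
      exact this.imp_left (congrArg f)
    | Coh =>
      rw [Alg.eval_or_eq_top, Alg.eval_imp_eq_top]
      have := he _ (List.mem_singleton_self _)
      rw [Alg.eval_or_eq_top] at this
      refine this.imp_left fun k => ?_
      obtain ⟨k1, k2⟩ := inf_eq_top_iff.1
        (show 𝔸.imp (𝔸.imp (e 0) ⊥) ⊥ ⊓ 𝔸.imp (e 0) (e 1) = ⊤ from k)
      exact hf.mono _ _ (le_bot_iff.1 (𝔸.imp_eq_top.1 k1)) (𝔸.imp_eq_top.1 k2)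

/-- Each condition is one axiom or rule read at a suitable valuation. -/
theorem Logic.IsAlgebra.isConsistency_circ {L : Logic S} {𝔹 : Alg S.addCirc A}
    (h : L.addCirc.IsAlgebra 𝔹) : 𝔹.reduct.IsConsistency 𝔹.circ where
  top := by
    have := h _ _ (L.addCirc.derives_of_rule (Or.inr CircRule.A2)) (fun _ => ⊥) (by simp)
    rwa [𝔹.eval_circ, 𝔹.eval_top] at this
  bot := h _ _ (L.addCirc.derives_of_rule (Or.inr CircRule.A3)) (fun _ => ⊥) (by simp)
  eq_bot x h0 h1 := by
    have := h _ _ (L.addCirc.derives_of_rule (Or.inr CircRule.A1)) (fun _ => x) (by simp)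
    have := 𝔹.imp_eq_top.1 this
    change (x ⊓ 𝔹.imp x ⊥) ⊓ 𝔹.circ x ≤ ⊥ at this
    simp only [le_bot_iff] at this
    rcases min_choice (x ⊓ 𝔹.imp x ⊥) (𝔹.circ x) with k | k
    · rcases min_choice x (𝔹.imp x ⊥) with k' | k'
      · exact absurd (k'.symm.trans (k.symm.trans this)) h0
      · exact absurd (k'.symm.trans (k.symm.trans this)) h1
    · exact k.symm.trans this
  mono x y hx hxy := by
    have := h _ _ (L.addCirc.derives_of_rule (Or.inr CircRule.Coh))
      -- The side formula of the rule is evaluated at `⊥`, so it can hold only if `⊥ = ⊤`, when the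
      -- claim is trivial.
      (fun n => if n = 0 then x else if n = 1 then y else ⊥) (by
        intro ψ hψ
        obtain rfl := List.mem_singleton.1 hψ
        rw [Alg.eval_or_eq_top]
        refine Or.inl (inf_eq_top_iff.2 ⟨?_, 𝔹.imp_eq_top.2 hxy⟩)
        exact 𝔹.imp_eq_top.2 (le_of_eq hx))
    rw [Alg.eval_or_eq_top, Alg.eval_imp_eq_top] at this
    rcases this with k | k
    · exact k
    · exact le_top.trans (k.symm.le.trans bot_le)

end

/-! ### Derived rules of `L_∘` and proof by cases -/

/-- The substitution of three given formulas for the first three variables. -/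
def Formula.subst₃ (α β γ : Formula S) : ℕ → Formula S
  | 0 => α
  | 1 => β
  | _ => γ

section Consequences

variable {L : Logic S} (hL : L.IsSemilinear)
include hL

/-- Whatever holds in all `L`-chains is derivable in `L_∘`, for all formulas of the expanded
language. -/
theorem Logic.IsSemilinear.addCirc_derives {Γ : Set (Formula S)} {φ : Formula S}
    (h : ∀ (A : Type u) [LinearOrder A] [BoundedOrder A] (𝔸 : Alg S A), L.IsAlgebra 𝔸 →
      𝔸.Entails Γ φ) (σ : ℕ → Formula S.addCirc) {Δ : Set (Formula S.addCirc)}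
    (hΔ : ∀ γ ∈ Γ, L.addCirc.Derives Δ (γ.lift.subst σ)) :
    L.addCirc.Derives Δ (φ.lift.subst σ) :=
  ((hL Γ φ).2 h).addCirc σ hΔ

variable {Δ : Set (Formula S.addCirc)} {α β γ : Formula S.addCirc}

/-- This and the next two lemmas reduce syntactic derivations in `L_∘` to order computations in
MTL-chains, for schemata with no, one or two premises. -/
theorem Logic.IsSemilinear.derives₀ (φ : Formula S)
    (h : ∀ (A : Type u) [LinearOrder A] [BoundedOrder A] (𝔸 : Alg S A) (e : ℕ → A),
      𝔸.eval e φ = ⊤) (α β γ : Formula S.addCirc) :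
    L.addCirc.Derives Δ (φ.lift.subst (subst₃ α β γ)) :=
  hL.addCirc_derives (Γ := ∅) (fun _ _ _ 𝔸 _ e _ => h _ 𝔸 e) _ (by simp)

theorem Logic.IsSemilinear.derives₁ (φ ψ : Formula S)
    (h : ∀ (A : Type u) [LinearOrder A] [BoundedOrder A] (𝔸 : Alg S A) (e : ℕ → A),
      𝔸.eval e φ = ⊤ → 𝔸.eval e ψ = ⊤) (α β γ : Formula S.addCirc)
    (hφ : L.addCirc.Derives Δ (φ.lift.subst (subst₃ α β γ))) :
    L.addCirc.Derives Δ (ψ.lift.subst (subst₃ α β γ)) :=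
  hL.addCirc_derives (Γ := {φ}) (fun _ _ _ 𝔸 _ e he => h _ 𝔸 e (he φ rfl)) _
    (by rintro _ rfl; exact hφ)

theorem Logic.IsSemilinear.derives₂ (φ χ ψ : Formula S)
    (h : ∀ (A : Type u) [LinearOrder A] [BoundedOrder A] (𝔸 : Alg S A) (e : ℕ → A),
      𝔸.eval e φ = ⊤ → 𝔸.eval e χ = ⊤ → 𝔸.eval e ψ = ⊤) (α β γ : Formula S.addCirc)
    (hφ : L.addCirc.Derives Δ (φ.lift.subst (subst₃ α β γ)))
    (hχ : L.addCirc.Derives Δ (χ.lift.subst (subst₃ α β γ))) :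
    L.addCirc.Derives Δ (ψ.lift.subst (subst₃ α β γ)) :=
  hL.addCirc_derives (Γ := {φ, χ})
    (fun _ _ _ 𝔸 _ e he => h _ 𝔸 e (he φ (Or.inl rfl)) (he χ (Or.inr rfl))) _
    (by rintro _ (rfl | rfl) <;> assumption)

theorem Logic.IsSemilinear.derives_or_left (h : L.addCirc.Derives Δ α) :
    L.addCirc.Derives Δ (or α β) :=
  hL.derives₁ (var 0) (or (var 0) (var 1))
    (fun _ _ _ 𝔸 e k => (𝔸.eval_or_eq_top e _ _).2 (Or.inl k)) α β β h

theorem Logic.IsSemilinear.derives_or_comm (h : L.addCirc.Derives Δ (or α β)) :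
    L.addCirc.Derives Δ (or β α) :=
  hL.derives₁ (or (var 0) (var 1)) (or (var 1) (var 0))
    (fun _ _ _ 𝔸 e k => by rw [Alg.eval_or_eq_top] at *; exact k.symm) α β β h

theorem Logic.IsSemilinear.derives_or_self (h : L.addCirc.Derives Δ (or α α)) :
    L.addCirc.Derives Δ α :=
  hL.derives₁ (or (var 0) (var 0)) (var 0)
    (fun _ _ _ 𝔸 e k => by rw [Alg.eval_or_eq_top] at k; exact k.elim id id) α α α h

theorem Logic.IsSemilinear.derives_or_bot (h : L.addCirc.Derives Δ (or α bot)) :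
    L.addCirc.Derives Δ α :=
  hL.derives₁ (or (var 0) bot) (var 0)
    (fun _ _ _ 𝔸 e k => by
      rw [Alg.eval_or_eq_top] at k
      exact k.elim id (fun k => top_le_iff.1 (k.symm.le.trans bot_le))) α α α h

theorem Logic.IsSemilinear.derives_or_assoc :
    L.addCirc.Derives Δ (or (or α β) γ) ↔ L.addCirc.Derives Δ (or α (or β γ)) :=
  ⟨hL.derives₁ (or (or (var 0) (var 1)) (var 2)) (or (var 0) (or (var 1) (var 2)))
    (fun _ _ _ 𝔸 e k => by simp only [Alg.eval_or_eq_top] at *; tauto) α β γ,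
   hL.derives₁ (or (var 0) (or (var 1) (var 2))) (or (or (var 0) (var 1)) (var 2))
    (fun _ _ _ 𝔸 e k => by simp only [Alg.eval_or_eq_top] at *; tauto) α β γ⟩

theorem Logic.IsSemilinear.derives_prelinear (α β : Formula S.addCirc) :
    L.addCirc.Derives Δ (or (imp α β) (imp β α)) :=
  hL.derives₀ (or (imp (var 0) (var 1)) (imp (var 1) (var 0)))
    (fun _ _ _ 𝔸 e => by
      simp only [Alg.eval_or_eq_top, Alg.eval_imp_eq_top]; exact le_total _ _) α β β

theorem Logic.IsSemilinear.derives_imp_refl (α : Formula S.addCirc) :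
    L.addCirc.Derives Δ (imp α α) :=
  hL.derives₀ (imp (var 0) (var 0))
    (fun _ _ _ 𝔸 e => (𝔸.eval_imp_eq_top e _ _).2 le_rfl) α α α

theorem Logic.IsSemilinear.derives_imp_trans (h : L.addCirc.Derives Δ (imp α β))
    (k : L.addCirc.Derives Δ (imp β γ)) : L.addCirc.Derives Δ (imp α γ) :=
  hL.derives₂ (imp (var 0) (var 1)) (imp (var 1) (var 2)) (imp (var 0) (var 2))
    (fun _ _ _ 𝔸 e => by simp only [Alg.eval_imp_eq_top]; exact le_trans) α β γ h k

theorem Logic.IsSemilinear.derives_equiv (h : L.addCirc.Derives Δ (imp α β))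
    (k : L.addCirc.Derives Δ (imp β α)) : L.addCirc.Derives Δ (equiv α β) :=
  hL.derives₂ (imp (var 0) (var 1)) (imp (var 1) (var 0)) (equiv (var 0) (var 1))
    (fun _ _ _ 𝔸 e => by
      simp only [Alg.eval_imp_eq_top, Alg.eval_equiv_eq_top]; exact le_antisymm) α β β h k

theorem Logic.IsSemilinear.derives_imp_of_equiv (h : L.addCirc.Derives Δ (equiv α β)) :
    L.addCirc.Derives Δ (imp α β) :=
  hL.derives₁ (equiv (var 0) (var 1)) (imp (var 0) (var 1))
    (fun _ _ _ 𝔸 e => by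
      simp only [Alg.eval_imp_eq_top, Alg.eval_equiv_eq_top]; exact le_of_eq) α β β h

theorem Logic.IsSemilinear.derives_top_imp :
    L.addCirc.Derives Δ (imp top α) ↔ L.addCirc.Derives Δ α :=
  ⟨hL.derives₁ (imp top (var 0)) (var 0)
    (fun _ _ _ 𝔸 e => by
      simp only [Alg.eval_imp_eq_top, Alg.eval_top]; exact top_le_iff.1) α α α,
   hL.derives₁ (var 0) (imp top (var 0))
    (fun _ _ _ 𝔸 e => by
      simp only [Alg.eval_imp_eq_top, Alg.eval_top]; exact top_le_iff.2) α α α⟩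

/-- The rules of `L_∘` are closed under forming disjunctions with a side formula. -/
theorem Logic.IsSemilinear.derives_or_of_derives {φ : Formula S.addCirc}
    (h : L.addCirc.Derives Δ φ) (δ : Formula S.addCirc) :
    L.addCirc.Derives ((fun ψ => or ψ δ) '' Δ) (or φ δ) := by
  induction h with
  | hyp hγ => exact .hyp ⟨_, hγ, rfl⟩
  | @rule r hr σ _ ih =>
    rcases hr with ⟨r, hr, rfl⟩ | hr
    -- Variables are shifted by one so that variable `0` is fresh and can stand for `δ`. In an
    -- `L`-chain, if that variable is not `⊤`, then all premises of the rule are, and so is its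
    -- conclusion.
    · let τ : ℕ → Formula S.addCirc := fun n => Nat.casesOn n δ σ
      have key : ∀ ψ : Formula S,
          (or (ψ.subst fun n => var (n + 1)) (var 0)).lift.subst τ = or (ψ.lift.subst σ) δ := by
        intro ψ
        change or ((ψ.subst fun n => var (n + 1)).lift.subst τ) δ = _
        rw [lift_subst, subst_subst]
        rfl
      change L.addCirc.Derives _ (or (r.conclusion.lift.subst σ) δ)
      rw [← key]
      refine hL.addCirc_derives
        (Γ := {χ | ∃ ψ ∈ r.premises, χ = or (ψ.subst fun n => var (n + 1)) (var 0)})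
        (fun _ _ _ 𝔸 h𝔸 e he => ?_) τ ?_
      · rw [Alg.eval_or_eq_top, Alg.eval_subst]
        by_cases h0 : 𝔸.eval e (var 0) = ⊤
        · exact Or.inr h0
        refine Or.inl (h𝔸 _ _ (L.derives_of_rule hr) _ fun ψ hψ => ?_)
        have := he _ ⟨ψ, hψ, rfl⟩
        rw [Alg.eval_or_eq_top, Alg.eval_subst] at this
        exact this.resolve_right h0
      · rintro _ ⟨ψ, hψ, rfl⟩
        rw [key]
        exact ih ψ.lift (List.mem_map_of_mem hψ)
    · have hr' : r ∈ L.addCirc.rules := Or.inr hr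
      cases hr with
      | A1 => exact hL.derives_or_left (.rule hr' σ (by simp))
      | A2 => exact hL.derives_or_left (.rule hr' σ (by simp))
      | A3 => exact hL.derives_or_left (.rule hr' σ (by simp))
      | Cong =>
        -- The rule already has a side formula; `δ` is absorbed into it by associativity.
        refine hL.derives_or_assoc.2 (Logic.Derives.rule hr'
          (subst₃ (σ 0) (σ 1) (or (σ 2) δ)) fun ψ hψ => ?_)
        obtain rfl := List.mem_singleton.1 hψ
        exact hL.derives_or_assoc.1 (ih _ hψ)
      | Coh =>
        refine hL.derives_or_assoc.2 (Logic.Derives.rule hr'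
          (subst₃ (σ 0) (σ 1) (or (σ 2) δ)) fun ψ hψ => ?_)
        obtain rfl := List.mem_singleton.1 hψ
        exact hL.derives_or_assoc.1 (ih _ hψ)

/-- Proof by cases in `L_∘`. -/
theorem Logic.IsSemilinear.derives_of_or {φ : Formula S.addCirc}
    (h : L.addCirc.Derives Δ (or α β)) (hα : L.addCirc.Derives (insert α Δ) φ)
    (hβ : L.addCirc.Derives (insert β Δ) φ) : L.addCirc.Derives Δ φ := by
  have h1 : L.addCirc.Derives Δ (or φ β) := by
    refine (hL.derives_or_of_derives hα β).cut ?_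
    rintro _ ⟨γ, rfl | hγ, rfl⟩
    · exact h
    · exact hL.derives_or_left (.hyp hγ)
  refine hL.derives_or_self ((hL.derives_or_of_derives hβ φ).cut ?_)
  rintro _ ⟨γ, rfl | hγ, rfl⟩
  · exact hL.derives_or_comm h1
  · exact hL.derives_or_left (.hyp hγ)

end Consequences

/-! ### Linear theories, Lindenbaum chains and semilinearity of `L_∘` -/

/-- Derivations are finitary: the union of a chain of sets derives no more than its members. -/
theorem Logic.Derives.exists_mem_of_sUnion {L : Logic S} {c : Set (Set (Formula S))}
    (hc : IsChain (· ⊆ ·) c) (hne : c.Nonempty) {φ : Formula S} (h : L.Derives (⋃₀ c) φ) :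
    ∃ Γ ∈ c, L.Derives Γ φ := by
  induction h with
  | hyp hγ =>
    obtain ⟨Γ, hΓ, k⟩ := hγ
    exact ⟨Γ, hΓ, .hyp k⟩
  | @rule r hr σ _ ih =>
    suffices H : ∀ l : List (Formula S), (∀ ψ ∈ l, ∃ Γ ∈ c, L.Derives Γ (ψ.subst σ)) →
        ∃ Γ ∈ c, ∀ ψ ∈ l, L.Derives Γ (ψ.subst σ) by
      obtain ⟨Γ, hΓ, k⟩ := H _ ih
      exact ⟨Γ, hΓ, .rule hr σ k⟩
    intro l
    induction l with
    | nil => exact fun _ => ⟨hne.some, hne.some_mem, by simp⟩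
    | cons ψ l il =>
      intro hl
      obtain ⟨Γ, hΓ, k⟩ := il fun χ hχ => hl χ (List.mem_cons_of_mem _ hχ)
      obtain ⟨Γ', hΓ', k'⟩ := hl ψ List.mem_cons_self
      rcases hc.total hΓ hΓ' with hs | hs
      · refine ⟨Γ', hΓ', fun χ hχ => ?_⟩
        rcases List.mem_cons.1 hχ with rfl | hχ
        · exact k'
        · exact (k χ hχ).cut fun γ hγ => .hyp (hs hγ)
      · refine ⟨Γ, hΓ, fun χ hχ => ?_⟩
        rcases List.mem_cons.1 hχ with rfl | hχ
        · exact k'.cut fun γ hγ => .hyp (hs hγ)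
        · exact k χ hχ

/-- Every set not deriving `φ` in `L_∘` extends to a linear theory not deriving `φ`. -/
theorem Logic.IsSemilinear.exists_linear {L : Logic S} (hL : L.IsSemilinear)
    {Δ : Set (Formula S.addCirc)} {φ : Formula S.addCirc} (h : ¬ L.addCirc.Derives Δ φ) :
    ∃ Γ, Δ ⊆ Γ ∧ ¬ L.addCirc.Derives Γ φ ∧
      ∀ α β, L.addCirc.Derives Γ (imp α β) ∨ L.addCirc.Derives Γ (imp β α) := by
  obtain ⟨Γ, hΔ, hΓ⟩ := zorn_subset_nonempty {Γ | ¬ L.addCirc.Derives Γ φ}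
    (fun c hc hchain hne => ⟨⋃₀ c, fun k => by
      obtain ⟨Γ, hΓ, k'⟩ := k.exists_mem_of_sUnion hchain hne
      exact hc hΓ k', fun Γ hΓ => Set.subset_sUnion_of_mem hΓ⟩) Δ h
  refine ⟨Γ, hΔ, hΓ.prop, fun α β => ?_⟩
  -- By maximality, a formula not derivable from `Γ` yields `φ` once added. Were this so for both
  -- implications, prelinearity and proof by cases would derive `φ` from `Γ`.
  have key : ∀ χ, L.addCirc.Derives Γ χ ∨ L.addCirc.Derives (insert χ Γ) φ := by
    intro χ
    by_contra! k
    exact k.1 (.hyp (hΓ.le_of_ge (y := insert χ Γ) k.2 (Set.subset_insert _ _)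
      (Set.mem_insert _ _)))
  refine (key (imp α β)).imp_right fun h1 => (key (imp β α)).resolve_right fun h2 => ?_
  exact hΓ.prop (hL.derives_of_or (hL.derives_prelinear α β) h1 h2)

/-- The Lindenbaum algebra of a linear theory, given as a quotient `q` of the formulas. -/
theorem Logic.IsSemilinear.exists_lindenbaum {L : Logic S} (hL : L.IsSemilinear)
    {Γ : Set (Formula S.addCirc)} {A : Type v} [LinearOrder A] (q : Formula S.addCirc → A)
    (hq : Function.Surjective q)
    (hle : ∀ α β, q α ≤ q β ↔ L.addCirc.Derives Γ (imp α β)) :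
    ∃ (_ : BoundedOrder A) (𝔸 : Alg S.addCirc A), L.addCirc.IsAlgebra 𝔸 ∧
      ∃ e, ∀ ψ, 𝔸.eval e ψ = ⊤ ↔ L.addCirc.Derives Γ ψ := by
  obtain ⟨s, hs⟩ := hq.hasRightInverse
  have heq : ∀ {α β}, q α = q β ↔
      L.addCirc.Derives Γ (imp α β) ∧ L.addCirc.Derives Γ (imp β α) := by
    intro α β; rw [le_antisymm_iff, hle, hle]
  have heqv : ∀ {α β}, q α = q β → L.addCirc.Derives Γ (equiv α β) :=
    fun h => hL.derives_equiv (heq.1 h).1 (heq.1 h).2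
  have hle0 : ∀ (φ ψ : Formula S), (∀ (B : Type u) [LinearOrder B] [BoundedOrder B] (𝔹 : Alg S B)
      (e : ℕ → B), 𝔹.eval e φ ≤ 𝔹.eval e ψ) → ∀ α β γ,
      q (φ.lift.subst (subst₃ α β γ)) ≤ q (ψ.lift.subst (subst₃ α β γ)) := by
    intro φ ψ h α β γ
    exact (hle _ _).2 (hL.derives₀ (imp φ ψ)
      (fun _ _ _ 𝔹 e => (𝔹.eval_imp_eq_top e _ _).2 (h _ 𝔹 e)) α β γ)
  have heq0 : ∀ (φ ψ : Formula S), (∀ (B : Type u) [LinearOrder B] [BoundedOrder B] (𝔹 : Alg S B)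
      (e : ℕ → B), 𝔹.eval e φ = 𝔹.eval e ψ) → ∀ α β γ,
      q (φ.lift.subst (subst₃ α β γ)) = q (ψ.lift.subst (subst₃ α β γ)) := fun φ ψ h α β γ =>
    le_antisymm (hle0 φ ψ (fun _ _ _ 𝔹 e => (h _ 𝔹 e).le) α β γ)
      (hle0 ψ φ (fun _ _ _ 𝔹 e => (h _ 𝔹 e).ge) α β γ)
  let : BoundedOrder A :=
    { top := q top
      bot := q bot
      le_top := hq.forall.2 fun α => hle0 (var 0) top
        (fun _ _ _ 𝔹 e => by rw [Alg.eval_top]; exact le_top) α α α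
      bot_le := hq.forall.2 fun α => hle0 bot (var 0) (fun _ _ _ 𝔹 e => bot_le) α α α }
  have htop : ∀ ψ, q ψ = ⊤ ↔ L.addCirc.Derives Γ ψ := by
    intro ψ
    rw [← top_le_iff, ← hL.derives_top_imp]
    exact hle _ _
  have hcong : ∀ (c : S.addCirc.Conn) (x y : Fin (S.addCirc.arity c) → Formula S.addCirc),
      (∀ i, q (x i) = q (y i)) → q (conn c x) = q (conn c y) := by
    have main : ∀ (c : S.addCirc.Conn) (x y : Fin (S.addCirc.arity c) → Formula S.addCirc),
      (∀ i, q (x i) = q (y i)) → q (conn c x) ≤ q (conn c y) := by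
      rintro (c | c) x y h
      · let x' : Fin (S.arity c) → Formula S.addCirc := x
        let y' : Fin (S.arity c) → Formula S.addCirc := y
        -- With `n` the arity, variables below `n` carry the arguments `x` and the next `n` carry
        -- `y`. All arguments are thus exchanged at once: in every chain, equal arguments give equal
        -- values.
        let σ : ℕ → Formula S.addCirc := fun n =>
          if h : n < S.arity c then x' ⟨n, h⟩
          else if h : n - S.arity c < S.arity c then y' ⟨n - S.arity c, h⟩ else bot
        have hx : ∀ i : Fin (S.arity c), σ i = x' i := fun i => by simp [σ]
        have hy : ∀ i : Fin (S.arity c), σ (S.arity c + i) = y' i := fun i => by simp [σ]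
        have := hL.addCirc_derives (Δ := Γ)
          (Γ := {χ | ∃ i : Fin (S.arity c), χ = equiv (var i) (var (S.arity c + i))})
          (φ := imp (conn c fun i => var i) (conn c fun i => var (S.arity c + i)))
          (fun _ _ _ 𝔹 _ e he => by
            rw [Alg.eval_imp_eq_top]
            refine le_of_eq (congrArg (𝔹.op c) (funext fun i => ?_))
            exact (𝔹.eval_equiv_eq_top e _ _).1 (he _ ⟨i, rfl⟩)) σ (by
            rintro _ ⟨i, rfl⟩
            change L.addCirc.Derives Γ (equiv (σ i) (σ (S.arity c + i)))
            rw [hx, hy]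
            exact heqv (h i))
        rw [hle]
        have e1 : (conn c fun i => var (S := S) i).lift.subst σ = conn (S := S.addCirc) (.inl c) x :=
          congrArg (conn (S := S.addCirc) (Sum.inl c)) (funext hx)
        have e2 : (conn c fun i => var (S := S) (S.arity c + i)).lift.subst σ =
            conn (S := S.addCirc) (.inl c) y :=
          congrArg (conn (S := S.addCirc) (Sum.inl c)) (funext hy)
        rw [← e1, ← e2]
        exact this
      · have e : ∀ z : Fin (S.addCirc.arity (Sum.inr c)) → Formula S.addCirc,
            conn (S := S.addCirc) (Sum.inr c) z = circ (z (0 : Fin 1)) := fun z =>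
          congrArg (conn (S := S.addCirc) (Sum.inr c)) (funext fun i : Fin 1 => by
            rw [Subsingleton.elim i 0])
        rw [e, e, hle]
        -- The congruence rule for `∘` is used with side formula `bot`, which is then discarded.
        refine hL.derives_imp_of_equiv (hL.derives_or_bot ?_)
        refine Logic.Derives.rule (L := L.addCirc) (Or.inr CircRule.Cong)
          (subst₃ (x (0 : Fin 1)) (y (0 : Fin 1)) bot) fun ψ hψ => ?_
        obtain rfl := List.mem_singleton.1 hψ
        exact hL.derives_or_left (heqv (h (0 : Fin 1)))
    exact fun c x y h => le_antisymm (main c x y h) (main c y x fun i => (h i).symm)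
  have hamp : ∀ {α β γ δ}, q α = q γ → q β = q δ → q (amp α β) = q (amp γ δ) := by
    have h1 : ∀ α β γ, q α = q γ → q (amp α β) ≤ q (amp γ β) := fun α β γ h =>
      (hle _ _).2 (hL.derives₁ (equiv (var 0) (var 2))
        (imp (amp (var 0) (var 1)) (amp (var 2) (var 1))) (fun _ _ _ 𝔹 e k => by
          rw [Alg.eval_equiv_eq_top] at k
          rw [Alg.eval_imp_eq_top]
          exact (congrArg (𝔹.amp · _) k).le) α β γ (heqv h))
    have h2 : ∀ α β, q (amp α β) = q (amp β α) := fun α β =>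
      heq0 (amp (var 0) (var 1)) (amp (var 1) (var 0)) (fun _ _ _ 𝔹 e => 𝔹.amp_comm _ _) α β β
    intro α β γ δ h k
    have h3 : q (amp α β) = q (amp γ β) := le_antisymm (h1 _ _ _ h) (h1 _ _ _ h.symm)
    have h4 : q (amp β γ) = q (amp δ γ) := le_antisymm (h1 _ _ _ k) (h1 _ _ _ k.symm)
    rw [h3, h2, h4, h2]
  have hres : ∀ α β γ, q (amp α β) ≤ q γ ↔ q α ≤ q (imp β γ) := by
    intro α β γ
    rw [hle, hle]
    exact ⟨hL.derives₁ (imp (amp (var 0) (var 1)) (var 2)) (imp (var 0) (imp (var 1) (var 2)))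
      (fun _ _ _ 𝔹 e k => by
        rw [Alg.eval_imp_eq_top] at *; exact (𝔹.residuation _ _ _).1 k) α β γ,
      hL.derives₁ (imp (var 0) (imp (var 1) (var 2))) (imp (amp (var 0) (var 1)) (var 2))
      (fun _ _ _ 𝔹 e k => by
        rw [Alg.eval_imp_eq_top] at *; exact (𝔹.residuation _ _ _).2 k) α β γ⟩
  have himp : ∀ {α β γ δ}, q α = q γ → q β = q δ → q (imp α β) = q (imp γ δ) := by
    intro α β γ δ h k
    -- By residuation, the class of an implication is determined by products, already known to
    -- respect the quotient.
    refine eq_of_forall_le_iff (hq.forall.2 fun χ => ?_)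
    rw [← hres, ← hres, hamp rfl h, k]
  have hand : ∀ α β, q (and α β) = q α ⊓ q β := by
    intro α β
    refine eq_of_forall_le_iff (hq.forall.2 fun χ => ?_)
    rw [le_inf_iff]
    refine ⟨fun h => ⟨h.trans ?_, h.trans ?_⟩, fun h => (hle _ _).2 (hL.derives₂
      (imp (var 0) (var 1)) (imp (var 0) (var 2)) (imp (var 0) (and (var 1) (var 2)))
      (fun _ _ _ 𝔹 e => by simp only [Alg.eval_imp_eq_top]; exact le_inf)
      χ α β ((hle _ _).1 h.1) ((hle _ _).1 h.2))⟩
    · exact hle0 (and (var 0) (var 1)) (var 0) (fun _ _ _ 𝔹 e => inf_le_left) α β β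
    · exact hle0 (and (var 0) (var 1)) (var 1) (fun _ _ _ 𝔹 e => inf_le_right) α β β
  let 𝔸 : Alg S.addCirc A :=
    { amp := fun x y => q (amp (s x) (s y))
      imp := fun x y => q (imp (s x) (s y))
      amp_assoc := fun x y z => by
        rw [hamp (hs _) rfl, hamp (α := s x) rfl (hs _)]
        exact heq0 (amp (amp (var 0) (var 1)) (var 2)) (amp (var 0) (amp (var 1) (var 2)))
          (fun _ _ _ 𝔹 e => 𝔹.amp_assoc _ _ _) (s x) (s y) (s z)
      amp_comm := fun x y => heq0 (amp (var 0) (var 1)) (amp (var 1) (var 0))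
        (fun _ _ _ 𝔹 e => 𝔹.amp_comm _ _) (s x) (s y) (s y)
      top_amp := fun x => by
        refine (hamp (γ := top) (δ := s x) (hs _) rfl).trans ?_
        exact (heq0 (amp top (var 0)) (var 0)
          (fun _ _ _ 𝔹 e => (congrArg (𝔹.amp · (e 0)) (𝔹.eval_top e)).trans (𝔹.top_amp _)) (s x) (s x) (s x)).trans (hs x)
      residuation := fun x y z => by
        have := hres (s x) (s y) (s z)
        rwa [hs, hs] at this
      prelinear := fun x y => by
        rw [sup_eq_top_iff_of_linear, htop, htop, ← hle, ← hle]
        exact le_total _ _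
      op := fun c x => q (conn c fun i => s (x i)) }
  have heval : ∀ (e : ℕ → A) (φ : Formula S.addCirc),
      𝔸.eval e φ = q (φ.subst fun n => s (e n)) := by
    intro e φ
    induction φ with
    | var n => exact (hs _).symm
    | bot => rfl
    | and φ ψ h k =>
      rw [Alg.eval, h, k]; exact (hand _ _).symm
    | amp φ ψ h k =>
      rw [Alg.eval, h, k]; exact hamp (hs _) (hs _)
    | imp φ ψ h k =>
      rw [Alg.eval, h, k]; exact himp (hs _) (hs _)
    | conn c args h =>
      exact hcong c _ _ fun i => (hs _).trans (h i)
  refine ⟨inferInstance, 𝔸, ?_, fun n => q (var n), fun ψ => ?_⟩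
  -- Evaluating in the quotient amounts to substituting representatives, so validity of a rule is
  -- its application to formulas derivable from `Γ`.
  · refine L.addCirc.isAlgebra_of_rules 𝔸 fun r hr e he => ?_
    rw [heval, htop]
    refine .rule hr _ fun ψ hψ => ?_
    rw [← htop, ← heval]
    exact he ψ hψ
  · rw [← htop, heval]
    suffices h : q (ψ.subst fun n => s (q (var n))) = q ψ by rw [h]
    induction ψ with
    | var n => exact hs _
    | bot => rfl
    | and φ ψ h k =>
      rw [hand, ← h, ← k]; exact hand _ _
    | amp φ ψ h k => exact hamp h k
    | imp φ ψ h k => exact himp h k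
    | conn c args h => exact hcong c _ _ h

theorem Logic.IsSemilinear.addCirc {L : Logic S} (hL : L.IsSemilinear) :
    L.addCirc.IsSemilinear := by
  intro Δ φ
  refine ⟨fun h A _ _ 𝔸 h𝔸 => h𝔸 _ _ h, fun h => ?_⟩
  by_contra hφ
  obtain ⟨Γ, hΔ, hΓ, hlin⟩ := hL.exists_linear hφ
  -- Provable implication from the linear theory `Γ` is a total preorder; its antisymmetrization is
  -- the required chain.
  let : Preorder (Formula S.addCirc) :=
    { le := fun α β => L.addCirc.Derives Γ (imp α β)
      le_refl := fun α => hL.derives_imp_refl α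
      le_trans := fun α β γ h k => hL.derives_imp_trans h k }
  have : Std.Total (α := Formula S.addCirc) (· ≤ ·) := ⟨hlin⟩
  classical
  obtain ⟨_, 𝔸, h𝔸, e, he⟩ := hL.exists_lindenbaum (Γ := Γ)
    (toAntisymmetrization (α := Formula S.addCirc) (· ≤ ·)) Quotient.mk_surjective
    (fun α β => toAntisymmetrization_le_toAntisymmetrization_iff)
  exact hΓ ((he φ).1 (h _ 𝔸 h𝔸 e fun γ hγ => (he γ).2 (.hyp (hΔ hγ))))

/-! ### Transfer of finite order patterns and of consistency operators -/

/-- The disjunction of a list of formulas. -/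
def Formula.ors : List (Formula S) → Formula S
  | [] => bot
  | φ :: l => or φ (ors l)

theorem Alg.eval_ors {A : Type v} [LinearOrder A] [BoundedOrder A] [Nontrivial A] (𝔸 : Alg S A)
    (e : ℕ → A) (l : List (Formula S)) :
    𝔸.eval e (ors l) = ⊤ ↔ ∃ φ ∈ l, 𝔸.eval e φ = ⊤ := by
  induction l with
  | nil => exact ⟨fun h => absurd h bot_ne_top, by simp⟩
  | cons φ l ih => rw [ors, Alg.eval_or_eq_top, ih]; simp

/-- Under finite strong real-chain completeness, the order among the values of finitely many
formulas in a chain is realized in a real chain. -/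
theorem Logic.FSRC.exists_real_chain {L : Logic S} (hL : L.FSRC) {A : Type v} [LinearOrder A]
    [BoundedOrder A] [Nontrivial A] {𝔸 : Alg S A} (h𝔸 : L.IsAlgebra 𝔸) (e : ℕ → A)
    {F : Set (Formula S)} (hF : F.Finite) :
    ∃ 𝔹 : Alg S unitInterval, L.IsAlgebra 𝔹 ∧ ∃ e' : ℕ → unitInterval,
      ∀ φ ∈ F, ∀ ψ ∈ F, 𝔹.eval e' φ ≤ 𝔹.eval e' ψ ↔ 𝔸.eval e φ ≤ 𝔸.eval e ψ := by
  have hfin : ∀ p : Formula S × Formula S → Prop,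
      {χ | ∃ q ∈ F ×ˢ F, p q ∧ imp q.1 q.2 = χ}.Finite := fun p =>
    ((hF.prod hF).image fun q => imp q.1 q.2).subset (by
      rintro _ ⟨q, hq, _, rfl⟩; exact ⟨q, hq, rfl⟩)
  have hT := hfin fun q => 𝔸.eval e q.1 ≤ 𝔸.eval e q.2
  have hN := hfin fun q => ¬ 𝔸.eval e q.1 ≤ 𝔸.eval e q.2
  -- The valid comparisons do not entail the disjunction of the invalid ones, as `𝔸` itself shows; a
  -- real countermodel must then agree with `𝔸` on every comparison.
  have hnot : ¬ L.Derives
      {χ | ∃ q ∈ F ×ˢ F, 𝔸.eval e q.1 ≤ 𝔸.eval e q.2 ∧ imp q.1 q.2 = χ}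
      (ors hN.toFinset.toList) := fun h => by
    obtain ⟨χ, hχ, k⟩ := (𝔸.eval_ors e _).1 (h𝔸 _ _ h e (by
      rintro _ ⟨q, _, hq, rfl⟩
      exact (𝔸.eval_imp_eq_top e _ _).2 hq))
    rw [Finset.mem_toList, Set.Finite.mem_toFinset] at hχ
    obtain ⟨q, _, hq, rfl⟩ := hχ
    exact hq ((𝔸.eval_imp_eq_top e _ _).1 k)
  rw [hL _ _ hT] at hnot
  simp only [Alg.Entails, not_forall] at hnot
  obtain ⟨𝔹, h𝔹, e', he', hne⟩ := hnot
  refine ⟨𝔹, h𝔹, e', fun φ hφ ψ hψ => ⟨fun h => ?_, fun h => ?_⟩⟩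
  · by_contra k
    refine hne ((𝔹.eval_ors e' _).2 ⟨imp φ ψ, ?_, (𝔹.eval_imp_eq_top e' _ _).2 h⟩)
    rw [Finset.mem_toList, Set.Finite.mem_toFinset]
    exact ⟨(φ, ψ), ⟨hφ, hψ⟩, k, rfl⟩
  · exact (𝔹.eval_imp_eq_top e' _ _).1 (he' _ ⟨(φ, ψ), ⟨hφ, hψ⟩, h, rfl⟩)

/-- A finite part of a consistency operator on a chain can be transferred to another chain. -/
theorem Alg.IsConsistency.exists_transfer {A : Type v} [LinearOrder A] [BoundedOrder A]
    {𝔸 : Alg S A} {c : A → A} (hc : 𝔸.IsConsistency c) {B : Type w} [LinearOrder B]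
    [BoundedOrder B] [Nontrivial B] (𝔹 : Alg S B) {ι : Type*} (C : Finset ι) (a : ι → A)
    (b d : ι → B)
    (hbot : ∀ i ∈ C, b i = ⊥ ↔ a i = ⊥) (htop : ∀ i ∈ C, b i = ⊤ → a i = ⊤)
    (hneg : ∀ i ∈ C, 𝔹.imp (b i) ⊥ = ⊥ ↔ 𝔸.imp (a i) ⊥ = ⊥)
    (hle : ∀ i ∈ C, ∀ j ∈ C, b i ≤ b j → a i ≤ a j)
    (hd : ∀ i ∈ C, ∀ j ∈ C, c (a i) ≤ c (a j) → d i ≤ d j)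
    (hdtop : ∀ i ∈ C, c (a i) = ⊤ → d i = ⊤) (hdbot : ∀ i ∈ C, c (a i) = ⊥ → d i = ⊥) :
    ∃ f, 𝔹.IsConsistency f ∧ ∀ i ∈ C, f (b i) = d i := by
  classical
  -- A step function: the largest prescribed value at a marked point `b i ≤ x` with `¬(b i) = ⊥`,
  -- and `⊥` if there is none. It is monotone because the index set grows with `x`.
  let g : B → B := fun x => (C.filter fun i => b i ≤ x ∧ 𝔹.imp (b i) ⊥ = ⊥).sup d
  let f : B → B := fun x => if x = ⊥ ∨ x = ⊤ then ⊤ else if 𝔹.imp x ⊥ = ⊥ then g x else ⊥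
  have htop' : f ⊤ = ⊤ := if_pos (Or.inr rfl)
  have hbot' : f ⊥ = ⊤ := if_pos (Or.inl rfl)
  have hbotimp : ∀ x, 𝔹.imp x ⊥ = ⊥ → x ≠ ⊥ := by
    rintro _ h rfl
    rw [𝔹.bot_imp] at h
    exact top_ne_bot h
  refine ⟨f, ⟨htop', hbot', fun x h0 h1 => ?_, fun x y hx hxy => ?_⟩, fun i hi => ?_⟩
  · have : ¬ (x = ⊥ ∨ x = ⊤) := by
      rintro (rfl | rfl)
      · exact h0 rfl
      · exact h1 (𝔹.top_imp ⊥)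
    simp only [f, if_neg this, if_neg h1]
  · have h0 := hbotimp x hx
    by_cases h1 : y = ⊤
    · rw [h1, htop']; exact le_top
    have hy : 𝔹.imp y ⊥ = ⊥ := by
      -- Negation is antitone, so `¬y ≤ ¬x = ⊥`.
      refine le_bot_iff.1 (le_of_le_of_eq ?_ hx)
      rw [← 𝔹.residuation, 𝔹.amp_comm, 𝔹.residuation]
      exact hxy.trans (𝔹.le_imp_imp y ⊥)
    have hx' : ¬ (x = ⊥ ∨ x = ⊤) := by
      rintro (rfl | rfl)
      · exact h0 rfl
      · exact h1 (top_le_iff.1 hxy)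
    have hy' : ¬ (y = ⊥ ∨ y = ⊤) := by
      rintro (rfl | k)
      · exact h0 (le_bot_iff.1 hxy)
      · exact h1 k
    simp only [f, if_neg hx', if_neg hy', if_pos hx, if_pos hy, g]
    refine Finset.sup_mono fun j hj => ?_
    rw [Finset.mem_filter] at hj ⊢
    exact ⟨hj.1, hj.2.1.trans hxy, hj.2.2⟩
  · by_cases h0 : b i = ⊥
    · rw [h0, hbot', hdtop i hi]
      rw [(hbot i hi).1 h0, hc.bot]
    by_cases h1 : b i = ⊤
    · rw [h1, htop', hdtop i hi]
      rw [htop i hi h1, hc.top]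
    by_cases h2 : 𝔹.imp (b i) ⊥ = ⊥
    · simp only [f, if_neg (not_or.2 ⟨h0, h1⟩), if_pos h2, g]
      -- The supremum is attained at `i` itself: marked points below `b i` come from points below `a
      -- i`, where `c` is monotone.
      refine le_antisymm (Finset.sup_le fun j hj => ?_)
        (Finset.le_sup (Finset.mem_filter.2 ⟨hi, le_rfl, h2⟩))
      rw [Finset.mem_filter] at hj
      exact hd j hj.1 i hi
        (hc.mono _ _ ((hneg j hj.1).1 hj.2.2) (hle j hj.1 i hi hj.2.1))
    · simp only [f, if_neg (not_or.2 ⟨h0, h1⟩), if_neg h2]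
      refine (hdbot i hi (hc.eq_bot _ (fun k => h0 ((hbot i hi).2 k)) ?_)).symm
      rwa [Ne, ← hneg i hi]

/-! ### Replacing subformulas `∘χ` by variables -/

/-- The formulas `χ` such that `∘χ` is a subformula. -/
def Formula.circArgs : Formula S.addCirc → Set (Formula S.addCirc)
  | var _ => ∅
  | bot => ∅
  | and φ ψ => circArgs φ ∪ circArgs ψ
  | amp φ ψ => circArgs φ ∪ circArgs ψ
  | imp φ ψ => circArgs φ ∪ circArgs ψ
  | conn (Sum.inl _) args => ⋃ i, circArgs (args i)
  | conn (Sum.inr _) args => insert (args (0 : Fin 1)) (circArgs (args (0 : Fin 1)))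

/-- Replace the subformulas `∘χ` by variables with odd indices, according to a numbering of the
formulas `χ`. -/
def Formula.flatten (k : Formula S.addCirc → ℕ) : Formula S.addCirc → Formula S
  | var n => var (2 * n)
  | bot => bot
  | and φ ψ => and (flatten k φ) (flatten k ψ)
  | amp φ ψ => amp (flatten k φ) (flatten k ψ)
  | imp φ ψ => imp (flatten k φ) (flatten k ψ)
  | conn (Sum.inl c) args => conn c fun i => flatten k (args i)
  | conn (Sum.inr _) args => var (2 * k (args (0 : Fin 1)) + 1)

theorem Formula.finite_circArgs (φ : Formula S.addCirc) : φ.circArgs.Finite := by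
  induction φ with
  | var n => exact Set.finite_empty
  | bot => exact Set.finite_empty
  | and φ ψ h k => exact h.union k
  | amp φ ψ h k => exact h.union k
  | imp φ ψ h k => exact h.union k
  | conn c args h =>
    rcases c with c | c
    · exact Set.finite_iUnion h
    · exact (h (0 : Fin 1)).insert _

theorem Formula.circArgs_subset {φ χ : Formula S.addCirc} (h : χ ∈ φ.circArgs) :
    χ.circArgs ⊆ φ.circArgs := by
  induction φ with
  | var n => exact h.elim
  | bot => exact h.elim
  | and φ ψ h₁ h₂ | amp φ ψ h₁ h₂ | imp φ ψ h₁ h₂ =>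
    rcases h with h | h
    · exact (h₁ h).trans Set.subset_union_left
    · exact (h₂ h).trans Set.subset_union_right
  | conn c args ih =>
    rcases c with c | c
    · obtain ⟨i, hi⟩ := Set.mem_iUnion.1 h
      exact (ih i hi).trans (Set.subset_iUnion (fun i => (args i).circArgs) i)
    · rcases h with rfl | h
      · exact Set.subset_insert _ _
      · exact (ih (0 : Fin 1) h).trans (Set.subset_insert _ _)

/-- The condition on the variable for `∘χ` is required only once `χ` is known to be evaluated
correctly, which the induction supplies. This suits a chain where `∘` is known only at the values of
the flattened `χ`. -/
theorem Alg.eval_flatten {A : Type v} [Lattice A] [BoundedOrder A] (𝔹 : Alg S.addCirc A)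
    (e e' : ℕ → A) (k : Formula S.addCirc → ℕ) (h0 : ∀ n, e' (2 * n) = e n)
    (φ : Formula S.addCirc)
    (h : ∀ χ ∈ φ.circArgs, 𝔹.reduct.eval e' (χ.flatten k) = 𝔹.eval e χ →
      e' (2 * k χ + 1) = 𝔹.circ (𝔹.eval e χ)) :
    𝔹.reduct.eval e' (φ.flatten k) = 𝔹.eval e φ := by
  induction φ with
  | var n => exact h0 n
  | bot => rfl
  | and φ ψ h₁ h₂ =>
    exact congrArg₂ (· ⊓ ·) (h₁ fun χ hχ => h χ (Or.inl hχ)) (h₂ fun χ hχ => h χ (Or.inr hχ))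
  | amp φ ψ h₁ h₂ =>
    exact congrArg₂ 𝔹.amp (h₁ fun χ hχ => h χ (Or.inl hχ)) (h₂ fun χ hχ => h χ (Or.inr hχ))
  | imp φ ψ h₁ h₂ =>
    exact congrArg₂ 𝔹.imp (h₁ fun χ hχ => h χ (Or.inl hχ)) (h₂ fun χ hχ => h χ (Or.inr hχ))
  | conn c args ih =>
    rcases c with c | c
    · exact congrArg (𝔹.op (Sum.inl c)) (funext fun i =>
        ih i fun χ hχ => h χ (Set.mem_iUnion.2 ⟨i, hχ⟩))
    · refine (h _ (Set.mem_insert _ _)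
        (ih (0 : Fin 1) fun χ hχ => h χ (Set.mem_insert_of_mem _ hχ))).trans ?_
      exact congrArg (𝔹.op (Sum.inr c)) (funext fun i : Fin 1 => by rw [Subsingleton.elim i 0])

/-! ### The two directions of the equivalence -/

theorem Logic.FSRC.of_addCirc {L : Logic S} (hsemi : L.IsSemilinear) (h : L.addCirc.FSRC) :
    L.FSRC := by
  refine fun T φ hT => ⟨fun hφ 𝔸 h𝔸 => h𝔸 _ _ hφ, fun H => (hsemi T φ).2 ?_⟩
  intro A _ _ 𝔸 h𝔸 e he
  by_contra hne
  have hlift : L.addCirc.Derives (Formula.lift '' T) φ.lift := by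
    refine (h _ _ (hT.image _)).2 fun 𝔹 h𝔹 e' he' => ?_
    rw [𝔹.eval_lift]
    refine H 𝔹.reduct h𝔹.reduct e' fun γ hγ => ?_
    rw [← 𝔹.eval_lift]
    exact he' _ ⟨γ, hγ, rfl⟩
  classical
  -- The least possible consistency operator. Monotonicity needs `⊥ ≠ ⊤`, which the failure `hne`
  -- provides.
  have hcons : 𝔸.IsConsistency fun x => if x = ⊥ ∨ x = ⊤ then ⊤ else ⊥ :=
    { top := if_pos (Or.inr rfl)
      bot := if_pos (Or.inl rfl)
      eq_bot := fun x h0 h1 => if_neg (by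
        rintro (rfl | rfl)
        · exact h0 rfl
        · exact h1 (𝔸.top_imp ⊥))
      mono := fun x y hx hxy => by
        split_ifs with h1 h2
        · exact le_rfl
        · exfalso
          rcases h1 with rfl | rfl
          · rw [𝔸.bot_imp] at hx
            exact hne (top_le_iff.1 (hx.le.trans bot_le))
          · exact h2 (Or.inr (top_le_iff.1 hxy))
        · exact le_top
        · exact le_rfl }
  have := (h𝔸.addCirc hcons) _ _ hlift e (by
    rintro _ ⟨γ, hγ, rfl⟩
    rw [Alg.eval_lift]
    exact he γ hγ)
  rw [Alg.eval_lift] at this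
  exact hne this

theorem Logic.FSRC.addCirc {L : Logic S} (hsemi : L.IsSemilinear) (hL : L.FSRC) :
    L.addCirc.FSRC := by
  refine fun T φ hT => ⟨fun hφ 𝔸 h𝔸 => h𝔸 _ _ hφ, fun H => (hsemi.addCirc T φ).2 ?_⟩
  intro A _ _ 𝔸 h𝔸 e he
  by_contra hne
  have hA : Nontrivial A := ⟨_, _, hne⟩
  have : Nonempty (Formula S.addCirc) := ⟨φ⟩
  set G : Set (Formula S.addCirc) := insert φ T
  have hGfin : G.Finite := hT.insert φ
  set C : Set (Formula S.addCirc) := ⋃ ψ ∈ G, ψ.circArgs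
  have hCfin : C.Finite := hGfin.biUnion fun ψ _ => ψ.finite_circArgs
  have hGC : ∀ ψ ∈ G, ψ.circArgs ⊆ C := fun ψ hψ => Set.subset_biUnion_of_mem hψ
  have hCC : ∀ ψ ∈ C, ψ.circArgs ⊆ C := fun ψ hψ => by
    obtain ⟨χ, hχ, k⟩ := Set.mem_iUnion₂.1 hψ
    exact (circArgs_subset k).trans (hGC χ hχ)
  obtain ⟨k, hk⟩ := Set.countable_iff_exists_injOn.1 hCfin.countable
  -- Even indices carry the original variables, odd ones the values of `∘χ`, with `χ` recovered from
  -- its number.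
  let a : ℕ → A := fun n =>
    if n % 2 = 0 then e (n / 2) else 𝔸.circ (𝔸.eval e (Function.invFunOn k C (n / 2)))
  have ha0 : ∀ n, a (2 * n) = e n := fun n => by simp [a]
  have ha1 : ∀ χ ∈ C, a (2 * k χ + 1) = 𝔸.circ (𝔸.eval e χ) := fun χ hχ => by
    have h1 : (2 * k χ + 1) % 2 ≠ 0 := by omega
    have h2 : (2 * k χ + 1) / 2 = k χ := by omega
    simp only [a, if_neg h1, h2, hk.leftInvOn_invFunOn hχ]
  have haev : ∀ ψ, ψ.circArgs ⊆ C → 𝔸.reduct.eval a (ψ.flatten k) = 𝔸.eval e ψ :=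
    fun ψ hψ => 𝔸.eval_flatten e a k ha0 ψ fun χ hχ _ => ha1 χ (hψ hχ)
  -- All formulas whose comparisons matter: the constants, the premises and conclusion, and for each
  -- `χ` the flattened `χ`, its negation and the variable for `∘χ`.
  let F : Set (Formula S) := {top, bot} ∪ (flatten k '' G ∪ (flatten k '' C ∪
    ((fun χ => neg (flatten k χ)) '' C ∪ (fun χ => var (2 * k χ + 1)) '' C)))
  have hF : F.Finite := (Set.toFinite _).union ((hGfin.image _).union ((hCfin.image _).union
    ((hCfin.image _).union (hCfin.image _))))
  obtain ⟨𝔹, h𝔹, b, hb⟩ := hL.exists_real_chain h𝔸.reduct a hF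
  have hFtop : top ∈ F := Or.inl (Or.inl rfl)
  have hFbot : bot ∈ F := Or.inl (Or.inr rfl)
  have hFG : ∀ ψ ∈ G, ψ.flatten k ∈ F := fun ψ hψ => Or.inr (Or.inl ⟨ψ, hψ, rfl⟩)
  have hFC : ∀ ψ ∈ C, ψ.flatten k ∈ F := fun ψ hψ => Or.inr (Or.inr (Or.inl ⟨ψ, hψ, rfl⟩))
  have hFN : ∀ ψ ∈ C, neg (ψ.flatten k) ∈ F := fun ψ hψ =>
    Or.inr (Or.inr (Or.inr (Or.inl ⟨ψ, hψ, rfl⟩)))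
  have hFV : ∀ ψ ∈ C, var (2 * k ψ + 1) ∈ F := fun ψ hψ =>
    Or.inr (Or.inr (Or.inr (Or.inr ⟨ψ, hψ, rfl⟩)))
  have hb1 : ∀ ψ ∈ F, 𝔹.eval b ψ = ⊤ ↔ 𝔸.reduct.eval a ψ = ⊤ := fun ψ hψ => by
    have := hb _ hFtop _ hψ
    rwa [Alg.eval_top, Alg.eval_top, top_le_iff, top_le_iff] at this
  have hb0 : ∀ ψ ∈ F, 𝔹.eval b ψ = ⊥ ↔ 𝔸.reduct.eval a ψ = ⊥ := fun ψ hψ => by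
    have := hb _ hψ _ hFbot
    rwa [Alg.eval, Alg.eval, le_bot_iff, le_bot_iff] at this
  have haC : ∀ χ ∈ C, 𝔸.reduct.eval a (χ.flatten k) = 𝔸.eval e χ := fun χ hχ =>
    haev χ (hCC χ hχ)
  obtain ⟨f, hf, hfd⟩ := h𝔸.isConsistency_circ.exists_transfer 𝔹 hCfin.toFinset (𝔸.eval e)
    (fun χ => 𝔹.eval b (χ.flatten k)) (fun χ => b (2 * k χ + 1))
    (fun χ hχ => by
      rw [hCfin.mem_toFinset] at hχ
      rw [← haC χ hχ]; exact hb0 _ (hFC χ hχ))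
    (fun χ hχ h => by
      rw [hCfin.mem_toFinset] at hχ
      rw [← haC χ hχ]; exact (hb1 _ (hFC χ hχ)).1 h)
    (fun χ hχ => by
      rw [hCfin.mem_toFinset] at hχ
      rw [← haC χ hχ]; exact hb0 _ (hFN χ hχ))
    (fun χ hχ ψ hψ h => by
      rw [hCfin.mem_toFinset] at hχ hψ
      rw [← haC χ hχ, ← haC ψ hψ]; exact (hb _ (hFC χ hχ) _ (hFC ψ hψ)).1 h)
    (fun χ hχ ψ hψ h => by
      rw [hCfin.mem_toFinset] at hχ hψ
      rw [← ha1 χ hχ, ← ha1 ψ hψ] at h; exact (hb _ (hFV χ hχ) _ (hFV ψ hψ)).2 h)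
    (fun χ hχ h => by
      rw [hCfin.mem_toFinset] at hχ
      rw [← ha1 χ hχ] at h; exact (hb1 _ (hFV χ hχ)).2 h)
    (fun χ hχ h => by
      rw [hCfin.mem_toFinset] at hχ
      rw [← ha1 χ hχ] at h; exact (hb0 _ (hFV χ hχ)).2 h)
  -- In the real chain `f` takes the value of the variable for `∘χ` at the value of `χ`, so undoing
  -- the flattening preserves values.
  have hbev : ∀ ψ ∈ G, 𝔹.eval b (ψ.flatten k) = (𝔹.addCirc f).eval (fun n => b (2 * n)) ψ :=
    fun ψ hψ => (𝔹.addCirc f).eval_flatten (fun n => b (2 * n)) b k (fun _ => rfl) ψ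
      fun χ hχ h => by
        rw [← h]
        exact (hfd χ (hCfin.mem_toFinset.2 (hGC ψ hψ hχ))).symm
  have htrans : ∀ ψ ∈ G, (𝔹.addCirc f).eval (fun n => b (2 * n)) ψ = ⊤ ↔ 𝔸.eval e ψ = ⊤ :=
    fun ψ hψ => by
      rw [← hbev ψ hψ, ← haev ψ (hGC ψ hψ)]
      exact hb1 _ (hFG ψ hψ)
  refine hne ((htrans φ (Set.mem_insert _ _)).1 (H _ (h𝔹.addCirc hf) _ fun γ hγ => ?_))
  exact (htrans γ (Set.mem_insert_of_mem _ hγ)).2 (he γ hγ)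

end FuzzyLFI

theorem mainTheorem2 (S : FuzzyLFI.Signature.{u}) (L : FuzzyLFI.Logic S)
    (hcore : L.IsCoreExpansion) (hsemi : L.IsSemilinear) :
    L.FSRC ↔ L.addCirc.FSRC :=
  ⟨fun h => h.addCirc hsemi, fun h => h.of_addCirc hsemi⟩
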